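/- **Theorem 3.3.** Let $K$ be a field of characteristic $0$, $q\in K$ with $q\neq 0$, and $n\ge 2$. Let $D_q(n)$ be the associative unital $K$-algebra with generators $d_{ij}$ $(1\le i,j\le n)$ and defining relations $$\begin{array}{ll} d_{ij}d_{st}=q\,d_{st}d_{ij}, & i>s,\ j\le t,\\ d_{ij}d_{st}=d_{st}d_{ij}+(q-1)\,d_{sj}d_{it}, & i>s,\ j>t,\\ d_{ij}d_{ik}=d_{ik}d_{ij}, & \text{all } i,j,k. \end{array}$$ List the generators in the order $d_{11},d_{12},\dots,d_{1n},d_{21},\dots,d_{nn}$ as $a_1,\dots,a_N$, $N=n^2$. Then $D_q(n)$ is a solvable polynomial algebra with respect to $a_1,\dots,a_N$; that is: 1. the ordered monomials $a^\alpha=a_1^{\alpha_1}\cdots a_N^{\alpha_N}$, $\alpha\in\mathbb N^N$, are pairwise distinct and form a $K$-basis $\mathcal B$ of $D_q(n)$ (a PBW basis); 2. there is a monomial ordering $\prec$ on $\mathcal B$, i.e. a well-ordering such that, writing $\mathbf{LM}(f)$ for the $\prec$-largest element of $\mathcal B$ occurring with nonzero coefficient in a nonzero $f\in D_q(n)$,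 for all $\alpha,\beta,\gamma,\eta\in\mathbb N^N$: (i) if $a^\gamma\ne1$, $a^\beta\neq a^\gamma$, $a^\alpha a^\beta a^\eta\ne 0$ and $a^\gamma=\mathbf{LM}(a^\alpha a^\beta a^\eta)$, then $a^\beta\prec a^\gamma$; (ii) if $a^\alpha\prec a^\beta$, both $a^\gamma a^\alpha a^\eta$ and $a^\gamma a^\beta a^\eta$ are nonzero, and $\mathbf{LM}(a^\gamma a^\beta a^\eta)\ne1$, then $\mathbf{LM}(a^\gamma a^\alpha a^\eta)\prec\mathbf{LM}(a^\gamma a^\beta a^\eta)$; and, for this same ordering, for all $1\le i<j\le N$ there are $\lambda_{ji}\in K\setminus\{0\}$ and $f_{ji}\in D_q(n)$ with $$a_ja_i=\lambda_{ji}\,a_ia_j+f_{ji},\qquad \mathbf{LM}(f_{ji})\prec a_ia_j\ \text{ whenever } f_{ji}\neq0 .$$ -/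

import Mathlib

/-! ### Algebras with a PBW basis, monomial orderings, solvable polynomial algebras -/

namespace SolvablePoly

section

variable {ι K A : Type*} [LinearOrder ι] [Fintype ι] [Field K] [Ring A] [Algebra K A]

/-- The ordered monomial `a ^ α = ∏ a i ^ α i`, the factors being multiplied in increasing order
of the index `i`. -/
def orderedMonomial (a : ι → A) (α : ι → ℕ) : A :=
  (((Finset.univ : Finset ι).sort (· ≤ ·)).map fun i => a i ^ α i).prod

/-- `b` is the PBW `K`-basis of `A` given by the ordered monomials in the family `a`. -/
def IsPBWBasis (a : ι → A) (b : Module.Basis (ι → ℕ) K A) : Prop :=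
  ∀ α, b α = orderedMonomial a α

/-- Monomials `b α` are identified with their exponents `α`, so a relation `lt` on exponents is a
relation on the basis. `IsLM b lt f γ` says that `b γ` is the leading monomial of `f`: the
`lt`-greatest monomial that occurs in `f` with nonzero coefficient. The element `0` has none. -/
def IsLM (b : Module.Basis (ι → ℕ) K A) (lt : (ι → ℕ) → (ι → ℕ) → Prop) (f : A)
    (γ : ι → ℕ) : Prop :=
  b.repr f γ ≠ 0 ∧ ∀ δ, b.repr f δ ≠ 0 → δ = γ ∨ lt δ γ

/-- `lt` is (the strict part of) a monomial ordering on the PBW basis `b`; the monomial `1` is the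
one with exponent `0`. -/
structure IsMonomialOrdering (b : Module.Basis (ι → ℕ) K A)
    (lt : (ι → ℕ) → (ι → ℕ) → Prop) : Prop where
  /-- strict total order in which every nonempty subset has a minimal element -/
  wellOrder : IsWellOrder (ι → ℕ) lt
  /-- if `b γ = LM (b α * b β * b η)` with `b γ ≠ 1` and `b β ≠ b γ`, then `b β ≺ b γ` -/
  lt_of_isLM : ∀ α β η γ : ι → ℕ, γ ≠ 0 → β ≠ γ → IsLM b lt (b α * b β * b η) γ → lt β γ
  /-- if `b α ≺ b β`, then `LM (b γ * b α * b η) ≺ LM (b γ * b β * b η)`, provided that both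
  products are nonzero and the second leading monomial is not `1` -/
  mul_lt_mul : ∀ α β γ η μ ν : ι → ℕ, lt α β → IsLM b lt (b γ * b α * b η) μ →
    IsLM b lt (b γ * b β * b η) ν → ν ≠ 0 → lt μ ν

/-- The `K`-algebra `A`, with the ordered family of generators `a`, is a solvable polynomial
algebra. For `i < j` the monomial `a i * a j` is the ordered monomial whose exponent is
`Pi.single i 1 + Pi.single j 1`. -/
def IsSolvablePolynomialAlgebra (K : Type*) [Field K] [Algebra K A] (a : ι → A) : Prop :=
  ∃ b : Module.Basis (ι → ℕ) K A, IsPBWBasis a b ∧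
    ∃ lt : (ι → ℕ) → (ι → ℕ) → Prop, IsMonomialOrdering b lt ∧
      ∀ i j : ι, i < j → ∃ c : K, c ≠ 0 ∧ ∃ f : A,
        a j * a i = c • (a i * a j) + f ∧
        (f ≠ 0 → ∃ μ, IsLM b lt f μ ∧ lt μ (Pi.single i 1 + Pi.single j 1))

end

end SolvablePoly

/-! ### The Dipper-Donkin quantized matrix algebra -/

namespace DipperDonkin

open FreeAlgebra in
/-- The defining relations of the quantized matrix algebra, on the free algebra with generators
indexed by pairs `(i, j)`. -/
inductive Rel {K : Type*} [Field K] (q : K) (n : ℕ) :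
    FreeAlgebra K (Fin n × Fin n) → FreeAlgebra K (Fin n × Fin n) → Prop
  | qcomm (i j s t : Fin n) : s < i → j ≤ t →
      Rel q n (ι K (i, j) * ι K (s, t)) (q • (ι K (s, t) * ι K (i, j)))
  | cross (i j s t : Fin n) : s < i → t < j →
      Rel q n (ι K (i, j) * ι K (s, t))
        (ι K (s, t) * ι K (i, j) + (q - 1) • (ι K (s, j) * ι K (i, t)))
  | row (i j k : Fin n) :
      Rel q n (ι K (i, j) * ι K (i, k)) (ι K (i, k) * ι K (i, j))

/-- The quantized matrix algebra: the quotient of the free algebra by the two-sided ideal generated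
by the defining relations. -/
abbrev Dq {K : Type*} [Field K] (q : K) (n : ℕ) : Type _ := RingQuot (Rel q n)

/-- The generator in row `i` and column `j`. -/
def gen {K : Type*} [Field K] (q : K) (n : ℕ) (i j : Fin n) : Dq q n :=
  RingQuot.mkAlgHom K (Rel q n) (FreeAlgebra.ι K (i, j))

end DipperDonkin

/-! Order exponents by degree, then lexicographically. Each relation lets two generators be
interchanged up to a nonzero scalar and a smaller quadratic word, so by well-founded induction every
word is a nonzero multiple of its sorted rearrangement plus smaller ordered monomials
(`exists_word_sub_smul_orderedMonomial_mem`). Ordered monomials therefore span. Once they are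
independent, the leading exponent of a product of monomials is the sum of the exponents
(`isLM_mul_mul`), and the monomial ordering axioms reduce to compatibility of the order with
addition.

Independence comes from a representation (`exists_quantumMatrix_end`) built one row at a time. The
new first row acts on Laurent polynomials by its commuting variables. The later rows act through the
product of the representation already built with a matrix of operators `transfer`, chosen to satisfy
the relations with those variables. Such a product again satisfies the relations
(`IsQuantumMatrix.mul`), because they say that the matrix commutes with a braiding. Since `transfer`
acts on the constant 1 as the identity matrix, a sorted monomial sends the vacuum vector `b 0` to
the basis vector with its own exponent; distinct exponents give distinct vectors. -/

namespace SolvablePoly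

/-- A monomial order, read on exponent vectors that are plain functions. -/
noncomputable def orderKey {ι : Type*} [Fintype ι] (m : MonomialOrder ι) : (ι → ℕ) ≃+ m.syn :=
  (Finsupp.linearEquivFunOnFinite ℕ ℕ ι).symm.toAddEquiv.trans m.toSyn

lemma IsLM.unique {ι K A : Type*} [Fintype ι] [Field K] [Ring A] [Algebra K A]
    {m : MonomialOrder ι} {b : Module.Basis (ι → ℕ) K A} {f : A} {γ δ : ι → ℕ}
    (h : IsLM b (fun α β => orderKey m α < orderKey m β) f γ)
    (h' : IsLM b (fun α β => orderKey m α < orderKey m β) f δ) : γ = δ := by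
  rcases h.2 δ h'.1 with e | h1
  · exact e.symm
  · rcases h'.2 γ h.1 with e | h2
    · exact e
    · exact absurd h1 h2.not_gt

/-! ### Words in the generators and their reduction to sorted form -/

section Straightening

variable {ι K A : Type*} [Field K] [Ring A] [Algebra K A]

/-- The product of the generators listed in `l`. -/
def word (a : ι → A) (l : List ι) : A := (l.map a).prod

@[simp] lemma word_nil (a : ι → A) : word a [] = 1 := rfl

@[simp] lemma word_cons (a : ι → A) (i : ι) (l : List ι) : word a (i :: l) = a i * word a l := by
  simp [word]

@[simp] lemma word_append (a : ι → A) (l l' : List ι) :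
    word a (l ++ l') = word a l * word a l' := by
  simp [word]

variable [LinearOrder ι]

/-- The exponent vector of a list of indices. -/
def wordExp (l : List ι) : ι → ℕ := fun i => l.count i

@[simp] lemma wordExp_nil : wordExp ([] : List ι) = 0 := by
  ext; simp [wordExp]

@[simp] lemma wordExp_cons (i : ι) (l : List ι) :
    wordExp (i :: l) = Pi.single i 1 + wordExp l := by
  ext j
  simp only [wordExp, List.count_cons, Pi.add_apply, Pi.single_apply, beq_iff_eq, eq_comm (a := i)]
  omega

@[simp] lemma wordExp_append (l l' : List ι) : wordExp (l ++ l') = wordExp l + wordExp l' := by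
  ext; simp [wordExp]

lemma wordExp_eq_iff_perm {l l' : List ι} : wordExp l = wordExp l' ↔ l.Perm l' := by
  rw [List.perm_iff_count]
  exact funext_iff

variable [Fintype ι]

/-- The increasing list of indices with exponent vector `α`. -/
def sortedWord (α : ι → ℕ) : List ι :=
  ((Finset.univ : Finset ι).sort (· ≤ ·)).flatMap fun i => List.replicate (α i) i

lemma word_sortedWord (a : ι → A) (α : ι → ℕ) : word a (sortedWord α) = orderedMonomial a α := by
  unfold sortedWord orderedMonomial
  induction (Finset.univ : Finset ι).sort (· ≤ ·) with
  | nil => simp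
  | cons i l ih =>
    rw [List.flatMap_cons, word_append, ih, List.map_cons, List.prod_cons]
    simp [word]

lemma pairwise_sortedWord (α : ι → ℕ) : (sortedWord α).Pairwise (· ≤ ·) := by
  unfold sortedWord
  have h : ((Finset.univ : Finset ι).sort (· ≤ ·)).Pairwise (· ≤ ·) := Finset.pairwise_sort _ _
  generalize (Finset.univ : Finset ι).sort (· ≤ ·) = L at h
  induction L with
  | nil => simp
  | cons i l ih =>
    rw [List.pairwise_cons] at h
    rw [List.flatMap_cons, List.pairwise_append]
    refine ⟨List.pairwise_replicate.2 (Or.inr le_rfl), ih h.2, ?_⟩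
    intro x hx y hy
    obtain ⟨z, hz, hy⟩ := List.mem_flatMap.1 hy
    rw [List.eq_of_mem_replicate hx, List.eq_of_mem_replicate hy]
    exact h.1 z hz

@[simp] lemma wordExp_sortedWord (α : ι → ℕ) : wordExp (sortedWord α) = α := by
  have key : ∀ (L : List ι), L.Nodup → ∀ i,
      (L.flatMap fun i => List.replicate (α i) i).count i = if i ∈ L then α i else 0 := by
    intro L hL i
    induction L with
    | nil => simp
    | cons j l ih =>
      rw [List.nodup_cons] at hL
      rw [List.flatMap_cons, List.count_append, ih hL.2, List.count_replicate]
      by_cases hij : j = i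
      · subst hij; simp [hL.1]
      · simp [hij, Ne.symm hij]
  ext i
  have := key _ (Finset.sort_nodup (Finset.univ : Finset ι) (· ≤ ·)) i
  simpa [wordExp, sortedWord] using this

variable (K) in
/-- The span of all words whose exponent vector is smaller than `γ`. -/
def lowerWords (m : MonomialOrder ι) (a : ι → A) (γ : ι → ℕ) : Submodule K A :=
  Submodule.span K {x | ∃ l, orderKey m (wordExp l) < orderKey m γ ∧ x = word a l}

variable (K) in
/-- The span of all ordered monomials whose exponent vector is smaller than `γ`. -/
def lowerMonomials (m : MonomialOrder ι) (a : ι → A) (γ : ι → ℕ) : Submodule K A :=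
  Submodule.span K {x | ∃ δ, orderKey m δ < orderKey m γ ∧ x = orderedMonomial a δ}

variable (K) in
/-- Generators can be interchanged up to a nonzero factor and smaller words. -/
def IsStraightening (m : MonomialOrder ι) (a : ι → A) : Prop :=
  ∀ i j, i < j → ∃ c : K, c ≠ 0 ∧
    a j * a i - c • (a i * a j) ∈ lowerWords K m a (Pi.single i 1 + Pi.single j 1)

lemma mul_mem_lowerWords (m : MonomialOrder ι) (a : ι → A) (l : List ι) {γ : ι → ℕ} {x : A}
    (hx : x ∈ lowerWords K m a γ) : word a l * x ∈ lowerWords K m a (wordExp l + γ) := by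
  induction hx using Submodule.span_induction with
  | mem x hx =>
    obtain ⟨l', h, rfl⟩ := hx
    refine Submodule.subset_span ⟨l ++ l', ?_, (word_append a l l').symm⟩
    rw [wordExp_append, map_add, map_add]
    gcongr
  | zero => simp
  | add x y _ _ hx hy => rw [mul_add]; exact add_mem hx hy
  | smul c x _ hx => rw [mul_smul_comm]; exact Submodule.smul_mem _ _ hx

lemma lowerWords_mul_mem (m : MonomialOrder ι) (a : ι → A) (l : List ι) {γ : ι → ℕ} {x : A}
    (hx : x ∈ lowerWords K m a γ) : x * word a l ∈ lowerWords K m a (γ + wordExp l) := by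
  induction hx using Submodule.span_induction with
  | mem x hx =>
    obtain ⟨l', h, rfl⟩ := hx
    refine Submodule.subset_span ⟨l' ++ l, ?_, (word_append a l' l).symm⟩
    rw [wordExp_append, map_add, map_add]
    gcongr
  | zero => simp
  | add x y _ _ hx hy => rw [add_mul]; exact add_mem hx hy
  | smul c x _ hx => rw [smul_mul_assoc]; exact Submodule.smul_mem _ _ hx

/-- A permutation is a chain of adjacent interchanges, and smaller words stay smaller when
multiplied by a word on either side, since the order is additive. -/
lemma exists_word_sub_smul_mem_of_perm {m : MonomialOrder ι} {a : ι → A}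
    (h : IsStraightening K m a) {l l' : List ι} (p : l.Perm l') :
    ∃ c : K, c ≠ 0 ∧ word a l - c • word a l' ∈ lowerWords K m a (wordExp l) := by
  induction p with
  | nil => exact ⟨1, one_ne_zero, by simp⟩
  | cons i p ih =>
    obtain ⟨c, hc, hm⟩ := ih
    refine ⟨c, hc, ?_⟩
    have := mul_mem_lowerWords m a [i] hm
    simpa [mul_sub] using this
  | swap i j l =>
    have swap : ∀ i j : ι, ∃ c : K, c ≠ 0 ∧
        a j * a i - c • (a i * a j) ∈ lowerWords K m a (Pi.single j 1 + Pi.single i 1) := by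
      intro i j
      rcases lt_trichotomy i j with hij | rfl | hij
      · rw [add_comm]; exact h i j hij
      · exact ⟨1, one_ne_zero, by simp⟩
      -- A pair in the opposite order is handled by solving the same relation for the other product,
      -- which needs the scalar to be invertible.
      · obtain ⟨c, hc, hm⟩ := h j i hij
        refine ⟨c⁻¹, inv_ne_zero hc, ?_⟩
        have := Submodule.smul_mem _ (-c⁻¹) hm
        convert this using 1
        rw [smul_sub, smul_smul, neg_mul, inv_mul_cancel₀ hc]
        simp only [neg_smul, one_smul]
        abel
    obtain ⟨c, hc, hm⟩ := swap i j
    refine ⟨c, hc, ?_⟩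
    have := lowerWords_mul_mem m a l hm
    simpa [sub_mul, mul_assoc, add_assoc] using this
  | trans p₁ _ ih₁ ih₂ =>
    obtain ⟨c, hc, hm⟩ := ih₁
    obtain ⟨d, hd, hn⟩ := ih₂
    refine ⟨c * d, mul_ne_zero hc hd, ?_⟩
    rw [wordExp_eq_iff_perm.2 p₁] at hm ⊢
    have := add_mem hm (Submodule.smul_mem _ c hn)
    simpa [smul_sub, smul_smul] using this

/-- Sorting leaves an error made of smaller words, not yet ordered; well-founded induction on the
exponent rewrites these in turn. -/
lemma exists_word_sub_smul_orderedMonomial_mem {m : MonomialOrder ι} {a : ι → A}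
    (h : IsStraightening K m a) (l : List ι) :
    ∃ c : K, c ≠ 0 ∧
      word a l - c • orderedMonomial a (wordExp l) ∈ lowerMonomials K m a (wordExp l) := by
  obtain ⟨s, hs⟩ : ∃ s, s = orderKey m (wordExp l) := ⟨_, rfl⟩
  induction s using WellFoundedLT.induction generalizing l with
  | ind s ih =>
    subst hs
    have hp : l.Perm (sortedWord (wordExp l)) := wordExp_eq_iff_perm.1 (by simp)
    obtain ⟨c, hc, hm⟩ := exists_word_sub_smul_mem_of_perm h hp
    refine ⟨c, hc, ?_⟩
    rw [word_sortedWord] at hm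
    refine Submodule.span_le.2 ?_ hm
    rintro _ ⟨l', hl', rfl⟩
    obtain ⟨d, -, hd⟩ := ih _ hl' l' rfl
    rw [SetLike.mem_coe, ← sub_add_cancel (word a l') (d • orderedMonomial a (wordExp l'))]
    refine add_mem (Submodule.span_mono ?_ hd)
      (Submodule.smul_mem _ _ (Submodule.subset_span ⟨_, hl', rfl⟩))
    rintro _ ⟨δ, hδ, rfl⟩
    exact ⟨δ, hδ.trans hl', rfl⟩

lemma span_orderedMonomial_eq_top {m : MonomialOrder ι} {a : ι → A}
    (h : IsStraightening K m a) (hgen : Algebra.adjoin K (Set.range a) = ⊤) :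
    Submodule.span K (Set.range (orderedMonomial a)) = ⊤ := by
  rw [eq_top_iff, ← Algebra.top_toSubmodule, ← hgen, Algebra.adjoin_eq_span, Submodule.span_le]
  intro x hx
  obtain ⟨L, hL, rfl⟩ := Submonoid.exists_list_of_mem_closure hx
  obtain ⟨l, rfl⟩ : ∃ l : List ι, L = l.map a := by
    clear hx
    induction L with
    | nil => exact ⟨[], rfl⟩
    | cons y L ih =>
      obtain ⟨i, rfl⟩ := hL y (by simp)
      obtain ⟨l, rfl⟩ := ih fun z hz => hL z (by simp [hz])
      exact ⟨i :: l, rfl⟩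
  obtain ⟨c, -, hm⟩ := exists_word_sub_smul_orderedMonomial_mem h l
  change word a l ∈ _
  rw [← sub_add_cancel (word a l) (c • orderedMonomial a (wordExp l))]
  refine add_mem (Submodule.span_mono ?_ hm)
    (Submodule.smul_mem _ _ (Submodule.subset_span ⟨_, rfl⟩))
  rintro _ ⟨δ, -, rfl⟩
  exact ⟨δ, rfl⟩

/-! ### Leading monomials and the ordering axioms, given a PBW basis -/

section Basis

variable {m : MonomialOrder ι} {a : ι → A} {b : Module.Basis (ι → ℕ) K A}

lemma repr_eq_zero_of_mem_lowerMonomials (hb : IsPBWBasis a b) {γ δ : ι → ℕ} {x : A}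
    (hx : x ∈ lowerMonomials K m a γ) (hδ : ¬ orderKey m δ < orderKey m γ) :
    b.repr x δ = 0 := by
  induction hx using Submodule.span_induction with
  | mem x hx =>
    obtain ⟨ε, hε, rfl⟩ := hx
    rw [← hb, Module.Basis.repr_self, Finsupp.single_apply, if_neg]
    rintro rfl
    exact hδ hε
  | zero => simp
  | add x y _ _ hx hy => simp [hx, hy]
  | smul c x _ hx => simp [hx]

/-- The straightening error only has coordinates strictly below the exponent of the word, so the
coefficient there is the nonzero straightening scalar and nothing lies above. -/
lemma isLM_word (h : IsStraightening K m a) (hb : IsPBWBasis a b) (l : List ι) :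
    IsLM b (fun α β => orderKey m α < orderKey m β) (word a l) (wordExp l) := by
  obtain ⟨c, hc, hm⟩ := exists_word_sub_smul_orderedMonomial_mem h l
  have key : ∀ δ, ¬ orderKey m δ < orderKey m (wordExp l) →
      b.repr (word a l) δ = c * Finsupp.single (wordExp l) 1 δ := by
    intro δ hδ
    have := repr_eq_zero_of_mem_lowerMonomials hb hm hδ
    rw [← hb, map_sub, map_smul, Module.Basis.repr_self] at this
    simpa [sub_eq_zero, -Finsupp.smul_single] using this
  refine ⟨?_, fun δ hδ => ?_⟩
  · rw [key _ (lt_irrefl _)]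
    simpa using hc
  · by_contra! hcon
    refine hδ ?_
    rw [key δ (not_lt.2 hcon.2), Finsupp.single_eq_of_ne hcon.1, mul_zero]

lemma isLM_mul_mul (h : IsStraightening K m a) (hb : IsPBWBasis a b) (α β η : ι → ℕ) :
    IsLM b (fun α β => orderKey m α < orderKey m β) (b α * b β * b η) (α + β + η) := by
  have := isLM_word h hb (sortedWord α ++ sortedWord β ++ sortedWord η)
  simpa only [word_append, wordExp_append, word_sortedWord, wordExp_sortedWord, ← hb _] using this

lemma isMonomialOrdering_of_isStraightening (h : IsStraightening K m a) (hb : IsPBWBasis a b) :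
    IsMonomialOrdering b fun α β => orderKey m α < orderKey m β where
  wellOrder :=
    { wf := InvImage.wf (orderKey m) wellFounded_lt
      trichotomous := fun α β h1 h2 => (orderKey m).injective
        (le_antisymm (not_lt.1 h2) (not_lt.1 h1)) }
  lt_of_isLM α β η γ _ hβγ hγ := by
    obtain rfl := (isLM_mul_mul h hb α β η).unique hγ
    refine lt_of_le_of_ne ?_ fun e => hβγ ((orderKey m).injective e)
    rw [map_add, map_add]
    exact le_add_of_le_of_nonneg (le_add_of_nonneg_left (m.zero_le _)) (m.zero_le _)
  mul_lt_mul α β γ η μ ν hαβ hμ hν _ := by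
    obtain rfl := (isLM_mul_mul h hb γ α η).unique hμ
    obtain rfl := (isLM_mul_mul h hb γ β η).unique hν
    simp only [map_add]
    gcongr

end Basis

end Straightening

end SolvablePoly

namespace DipperDonkin

/-! ### The relations as commutation with a braiding -/

section Relations

variable {K ι κ μ A B : Type*} [Field K] [LinearOrder ι] [LinearOrder κ] [LinearOrder μ]
  [Semiring A] [Algebra K A] [Semiring B] [Algebra K B]

/-- The (possibly rectangular) matrix `e` satisfies the Dipper-Donkin relations. -/
structure IsQuantumMatrix (q : K) (e : ι → κ → A) : Prop where
  qcomm : ∀ i s j t, s < i → j ≤ t → e i j * e s t = q • (e s t * e i j)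
  cross : ∀ i s j t, s < i → t < j →
    e i j * e s t = e s t * e i j + (q - 1) • (e s j * e i t)
  row : ∀ i j k, e i j * e i k = e i k * e i j

lemma IsQuantumMatrix.map {q : K} {e : ι → κ → A} (he : IsQuantumMatrix q e) (f : A →ₐ[K] B) :
    IsQuantumMatrix q fun i j => f (e i j) where
  qcomm i s j t h h' := by rw [← map_mul, he.qcomm i s j t h h', map_smul, map_mul]
  cross i s j t h h' := by
    rw [← map_mul, he.cross i s j t h h', map_add, map_smul, map_mul, map_mul]
  row i j k := by rw [← map_mul, he.row, map_mul]

/-- Diagonal part of the braiding: the entry in row `(i, s)` and column `(i, s)`. -/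
def braidDiag (q : K) (i s : ι) : K := if s < i then q - 1 else if i < s then 0 else q

/-- Off-diagonal part of the braiding: the entry in row `(i, s)` and column `(s, i)`. -/
def braidSwap (q : K) (i s : ι) : K := if s < i then q else if i < s then 1 else 0

/-- The Dipper-Donkin relations say that the matrix commutes with the braiding. -/
lemma isQuantumMatrix_iff {q : K} (hq : q ≠ 0) (e : ι → κ → A) :
    IsQuantumMatrix q e ↔ ∀ i s j t,
      braidDiag q i s • (e i j * e s t) + braidSwap q i s • (e s j * e i t) =
        braidDiag q j t • (e i j * e s t) + braidSwap q t j • (e i t * e s j) := by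
  constructor
  · intro h i s j t
    rcases lt_trichotomy s i with his | rfl | his
    · rcases lt_trichotomy t j with hjt | rfl | hjt
      · simp only [braidDiag, braidSwap, his, his.not_gt, hjt, hjt.not_gt, if_true, if_false,
          one_smul]
        rw [h.qcomm i s t j his hjt.le]
      · simp only [braidDiag, braidSwap, his, his.not_gt, lt_irrefl, if_true, if_false,
          zero_smul, add_zero,
          ]
        rw [h.qcomm i s t t his le_rfl]; module
      · simp only [braidDiag, braidSwap, his, his.not_gt, hjt, hjt.not_gt, if_true, if_false,
          zero_smul,  zero_add,
          ]
        rw [h.cross i s t j his hjt, h.qcomm i s j t his hjt.le]; module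
    · rcases lt_trichotomy t j with hjt | rfl | hjt
      · simp only [braidDiag, braidSwap, lt_irrefl, hjt, hjt.not_gt, if_true, if_false,
          zero_smul, add_zero,
          one_smul]
        rw [h.row s j t]; module
      · simp only [braidDiag, braidSwap, lt_irrefl, if_false,
          zero_smul, add_zero,
          ]
      · simp only [braidDiag, braidSwap, lt_irrefl, hjt, hjt.not_gt, if_true, if_false,
          zero_smul, add_zero, zero_add,
          ]
        rw [h.row s j t]
    · rcases lt_trichotomy t j with hjt | rfl | hjt
      · simp only [braidDiag, braidSwap, his, his.not_gt, hjt, hjt.not_gt, if_true, if_false,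
          zero_smul,  zero_add,
          one_smul]
        rw [h.cross s i j t his hjt]; abel
      · simp only [braidDiag, braidSwap, his, his.not_gt, lt_irrefl, if_true, if_false,
          zero_smul, add_zero, zero_add,
          one_smul]
        rw [h.qcomm s i t t his le_rfl]
      · simp only [braidDiag, braidSwap, his, his.not_gt, hjt, hjt.not_gt, if_true, if_false,
          zero_smul,  zero_add,
          one_smul]
        rw [h.qcomm s i j t his hjt.le]
  · intro h
    refine ⟨fun i s j t his hjt => ?_, fun i s j t his hjt => ?_, fun i j k => ?_⟩
    · have := h s i j t
      rcases hjt.lt_or_eq with hjt | rfl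
      · simpa [braidDiag, braidSwap, his, hjt, his.not_gt, hjt.not_gt] using this
      · simpa [braidDiag, braidSwap, his, his.not_gt] using this
    · have := h s i j t
      rw [add_comm]
      simpa [braidDiag, braidSwap, his, hjt, his.not_gt, hjt.not_gt] using this
    -- For equal rows the braiding identity is `q` times the row relation; `hq` allows the
    -- cancellation.
    · rcases lt_trichotomy j k with hjk | rfl | hjk
      · have := h i i j k
        simpa [braidDiag, braidSwap, hjk, hjk.not_gt, hq] using this
      · rfl
      · have := h i i k j
        simpa [braidDiag, braidSwap, hjk, hjk.not_gt, hq] using this.symm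

/-- The product of two mutually commuting quantum matrices is a quantum matrix. -/
lemma IsQuantumMatrix.mul [Fintype κ] {q : K} (hq : q ≠ 0) {e : ι → κ → A} {f : κ → μ → A}
    (he : IsQuantumMatrix q e) (hf : IsQuantumMatrix q f)
    (hc : ∀ i k l j, Commute (e i k) (f l j)) :
    IsQuantumMatrix q fun i j => ∑ k, e i k * f k j := by
  rw [isQuantumMatrix_iff hq] at he hf ⊢
  have hprod : ∀ i s j t, (∑ k, e i k * f k j) * (∑ k, e s k * f k t) =
      ∑ k, ∑ l, (e i k * e s l) * (f k j * f l t) := by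
    intro i s j t
    rw [Finset.sum_mul_sum]
    refine Finset.sum_congr rfl fun k _ => Finset.sum_congr rfl fun l _ => ?_
    rw [mul_assoc, ← mul_assoc (f k j), ← (hc s l k j).eq]
    simp only [mul_assoc]
  intro i s j t
  simp only [hprod, Finset.smul_sum]
  -- The braiding is first moved past `e`. Exchanging the two summation indices in the swap term
  -- then makes `e i k * e s l` a common left factor, and the braiding moves past `f`.
  have h1 : (∑ k, ∑ l, braidDiag q i s • ((e i k * e s l) * (f k j * f l t))) +
      ∑ k, ∑ l, braidSwap q i s • ((e s k * e i l) * (f k j * f l t)) =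
      (∑ k, ∑ l, braidDiag q k l • ((e i k * e s l) * (f k j * f l t))) +
      ∑ k, ∑ l, braidSwap q l k • ((e i l * e s k) * (f k j * f l t)) := by
    simp only [← Finset.sum_add_distrib]
    refine Finset.sum_congr rfl fun k _ => Finset.sum_congr rfl fun l _ => ?_
    simpa only [add_mul, smul_mul_assoc] using congrArg (· * (f k j * f l t)) (he i s k l)
  rw [h1, Finset.sum_comm (f := fun k l => braidSwap q l k • ((e i l * e s k) * (f k j * f l t)))]
  simp only [← Finset.sum_add_distrib]
  refine Finset.sum_congr rfl fun k _ => Finset.sum_congr rfl fun l _ => ?_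
  simpa only [mul_add, mul_smul_comm] using congrArg ((e i k * e s l) * ·) (hf k l j t)

end Relations

/-! ### Weighted shift operators on Laurent polynomials -/

section Laurent

variable {K κ : Type*} [Field K]

/-- The operator `x ^ α ↦ c α • x ^ (α + v)` on Laurent polynomials. -/
noncomputable def laurentOp (c : (κ → ℤ) → K) (v : κ → ℤ) : Module.End K ((κ → ℤ) →₀ K) :=
  Finsupp.linearCombination K fun α => Finsupp.single (α + v) (c α)

@[simp] lemma laurentOp_single (c : (κ → ℤ) → K) (v α : κ → ℤ) (x : K) :
    laurentOp c v (Finsupp.single α x) = Finsupp.single (α + v) (x * c α) := by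
  simp [laurentOp]

lemma laurentOp_mul (c d : (κ → ℤ) → K) (v w : κ → ℤ) :
    laurentOp c v * laurentOp d w = laurentOp (fun α => c (α + w) * d α) (v + w) := by
  ext α : 2
  simp [mul_comm, add_assoc, add_comm v w]

lemma laurentOp_add (c d : (κ → ℤ) → K) (v : κ → ℤ) :
    laurentOp c v + laurentOp d v = laurentOp (c + d) v := by
  ext α : 2
  simp

lemma smul_laurentOp (r : K) (c : (κ → ℤ) → K) (v : κ → ℤ) :
    r • laurentOp c v = laurentOp (r • c) v := by
  ext α : 2
  simp

variable [LinearOrder κ]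

/-- The scalar `∏ q ^ α t`, over all `t ∈ s`. -/
def weight (q : K) (s : Finset κ) (α : κ → ℤ) : K := q ^ ∑ t ∈ s, α t

lemma weight_add_single {q : K} (hq : q ≠ 0) (s : Finset κ) (α : κ → ℤ) (j : κ) :
    weight q s (α + Pi.single j 1) = weight q s α * if j ∈ s then q else 1 := by
  simp only [weight, Pi.add_apply, Finset.sum_add_distrib, zpow_add₀ hq, Finset.sum_pi_single']
  split_ifs <;> simp

lemma weight_sub_single {q : K} (hq : q ≠ 0) (s : Finset κ) (α : κ → ℤ) (j : κ) :
    weight q s (α - Pi.single j 1) = weight q s α * if j ∈ s then q⁻¹ else 1 := by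
  simp only [weight, Pi.sub_apply, Finset.sum_sub_distrib, zpow_sub₀ hq, Finset.sum_pi_single']
  split_ifs <;> simp [div_eq_mul_inv]

variable (K) in
/-- Multiplication by the variable `x t`. -/
noncomputable def mulVar (t : κ) : Module.End K ((κ → ℤ) →₀ K) :=
  laurentOp 1 (Pi.single t 1)

lemma mulVar_comm (s t : κ) : mulVar K s * mulVar K t = mulVar K t * mulVar K s := by
  simp [mulVar, laurentOp_mul, add_comm]

variable [LocallyFiniteOrderTop κ]

/-- Coefficient of the operator `transfer q k j`. -/
def transferCoeff (q : K) (k j : κ) (α : κ → ℤ) : K :=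
  if k = j then weight q (Finset.Ici k) α
  else if k < j then weight q (Finset.Ici k) α - weight q (Finset.Ioi k) α else 0

/-- The operators by which a generator is moved past a row of commuting variables. -/
noncomputable def transfer (q : K) (k j : κ) : Module.End K ((κ → ℤ) →₀ K) :=
  laurentOp (transferCoeff q k j) (Pi.single j 1 - Pi.single k 1)

/-- If `k ≤ j ≤ t`, raising the exponent of `x t` multiplies every weight in the coefficient by `q`;
if `j < k` the operator is zero. -/
lemma transfer_mul_mulVar_of_le {q : K} (hq : q ≠ 0) (k : κ) {j t : κ} (h : j ≤ t) :
    transfer q k j * mulVar K t = q • (mulVar K t * transfer q k j) := by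
  simp only [transfer, mulVar, laurentOp_mul, smul_laurentOp]
  congr 1
  · ext α
    simp only [transferCoeff, weight_add_single hq, Finset.mem_Ici, Finset.mem_Ioi, Pi.smul_apply,
      Pi.one_apply, smul_eq_mul]
    rcases lt_trichotomy k j with hk | rfl | hk
    · simp only [hk.ne, hk, hk.le.trans h, hk.trans_le h, if_true, if_false]
      ring
    · simp only [h, if_true]
      ring
    · simp [hk.ne', hk.not_gt]
  · abel

/-- For `k < j` the coefficient does not depend on `j`, so for `k < t` the correction supplies the
missing factor `q`. For `k = t` only the weight over `Ici k` is scaled, which is why the diagonal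
coefficient is that weight alone. -/
lemma transfer_mul_mulVar_of_lt {q : K} (hq : q ≠ 0) (k : κ) {j t : κ} (h : t < j) :
    transfer q k j * mulVar K t =
      mulVar K t * transfer q k j + (q - 1) • (mulVar K j * transfer q k t) := by
  have e : (Pi.single j 1 + (Pi.single t 1 - Pi.single k 1) : κ → ℤ) =
    Pi.single t 1 + (Pi.single j 1 - Pi.single k 1) := by abel
  simp only [transfer, mulVar, laurentOp_mul, smul_laurentOp, e, laurentOp_add]
  congr 1
  · ext α
    simp only [transferCoeff, weight_add_single hq, Finset.mem_Ici, Finset.mem_Ioi, Pi.smul_apply,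
      Pi.one_apply, Pi.add_apply, smul_eq_mul]
    rcases lt_trichotomy k j with hk | rfl | hk
    · rcases lt_trichotomy k t with hkt | rfl | hkt
      · simp only [hk.ne, hk, hkt, hkt.le, hkt.ne, if_true, if_false]
        ring
      · simp only [hk.ne, hk, le_rfl, lt_irrefl, if_true, if_false]
        ring
      · simp only [hk.ne, hk, hkt.not_ge, hkt.not_gt, hkt.ne', if_true, if_false]
        ring
    · simp [h.ne', h.not_ge, h.not_gt]
    · simp [hk.ne', hk.not_gt, (h.trans hk).ne', (h.trans hk).not_gt]
  · abel

/-- All products in a relation shift exponents by the same vector, so only coefficients are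
compared. A unit change of an exponent scales a weight by `q`, `q⁻¹` or 1, according to the relative
position of the indices. -/
lemma isQuantumMatrix_transfer {q : K} (hq : q ≠ 0) :
    IsQuantumMatrix q (transfer q : κ → κ → Module.End K ((κ → ℤ) →₀ K)) where
  qcomm i s j t his hjt := by
    simp only [transfer, laurentOp_mul, smul_laurentOp]
    congr 1
    · ext α
      simp only [transferCoeff, ← add_sub_assoc, weight_sub_single hq, weight_add_single hq,
        Finset.mem_Ici, Finset.mem_Ioi, Pi.smul_apply, smul_eq_mul]
      rcases lt_trichotomy i j with hij | rfl | hij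
      · have hit := hij.trans_le hjt
        have hst := his.trans hit
        have hsj := his.trans hij
        simp only [hij, hij.ne, hit, hit.le, hst, hst.ne, hsj, hsj.le, his, his.le, his.not_ge,
          his.not_gt, if_true, if_false]
        field_simp
      · have hst := his.trans_le hjt
        simp only [hjt, hst, hst.ne, his, his.le, his.not_ge, if_true, if_false]
        field_simp
      · simp [hij.ne', hij.not_gt]
    · abel
  cross i s j t his hjt := by
    have e : (Pi.single j 1 - Pi.single s 1 + (Pi.single t 1 - Pi.single i 1) : κ → ℤ) =
      Pi.single t 1 - Pi.single s 1 + (Pi.single j 1 - Pi.single i 1) := by abel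
    simp only [transfer, laurentOp_mul, smul_laurentOp, e, laurentOp_add]
    congr 1
    · ext α
      simp only [transferCoeff, ← add_sub_assoc, weight_sub_single hq, weight_add_single hq,
        Finset.mem_Ici, Finset.mem_Ioi, Pi.smul_apply, Pi.add_apply, smul_eq_mul]
      rcases lt_or_ge j i with hij | hij
      · have hti := hjt.trans hij
        simp [hij.ne', hij.not_gt, hti.ne', hti.not_gt]
      have hsj := his.trans_le hij
      rcases lt_trichotomy s t with hst | rfl | hst
      · rcases lt_trichotomy i t with hit | rfl | hit
        · have hij' := hit.trans hjt
          simp only [hij', hij'.ne, hit, hit.ne, hit.le, hst, hst.ne, hst.le, hsj, hsj.ne,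
            hsj.le, his, his.le, his.not_ge, his.not_gt, if_true, if_false]
          field_simp
          ring
        · simp only [hjt, hjt.ne, le_rfl, lt_irrefl, hst, hst.ne, hst.le, hsj, hsj.ne,
            hsj.le, his.not_ge, his.not_gt, if_true, if_false]
          field_simp
          ring
        · rcases hij.lt_or_eq with hij' | rfl
          · simp only [hij', hij'.ne, hit.ne', hit.not_gt, hit.not_ge, hst, hst.ne,
              hst.le, hsj, hsj.ne, hsj.le, his, his.le, his.not_ge, his.not_gt, if_true, if_false]
            field_simp
            ring
          · simp only [hit.ne', hit.not_gt, hit.not_ge, hst, hst.ne, hst.le, his, his.ne,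
              his.le, his.not_ge, his.not_gt, if_true, if_false]
            field_simp
            ring
      · rcases hij.lt_or_eq with hij' | rfl
        · simp only [hij', hij'.ne, hsj, hsj.ne, hsj.le, his, his.ne', his.le, his.not_ge,
            his.not_gt, if_true, if_false]
          field_simp
          ring
        · simp only [his, his.ne', his.le, his.not_ge, his.not_gt, if_true, if_false]
          field_simp
          ring
      · have hti := hst.trans his
        simp [hst.ne', hst.not_gt, hti.ne', hti.not_gt]
    · abel
  row i j k := by
    simp only [transfer, laurentOp_mul]
    congr 1
    · ext α
      simp only [transferCoeff, ← add_sub_assoc, weight_sub_single hq, weight_add_single hq,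
        Finset.mem_Ici, Finset.mem_Ioi]
      rcases lt_trichotomy i j with hij | rfl | hij
      · rcases lt_trichotomy i k with hik | rfl | hik
        · simp only [hij, hij.ne, hij.le, hik, hik.ne, hik.le, le_rfl, lt_irrefl, if_true,
            if_false]
        · simp only [hij, hij.ne, hij.le, le_rfl, lt_irrefl, if_true, if_false]
          field_simp
        · simp [hik.ne', hik.not_gt]
      · rcases lt_trichotomy i k with hik | rfl | hik
        · simp only [hik, hik.ne, hik.le, le_rfl, lt_irrefl, if_true, if_false]
          field_simp
        · rfl
        · simp [hik.ne', hik.not_gt]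
      · simp [hij.ne', hij.not_gt]
    · abel

/-- At exponent zero all weights equal 1, so the differences off the diagonal vanish. -/
lemma transfer_single_zero (q : K) (k j : κ) :
    transfer q k j (Finsupp.single 0 1) = if k = j then Finsupp.single 0 1 else 0 := by
  by_cases h : k = j
  · subst h
    simp [transfer, transferCoeff, weight]
  · simp [transfer, transferCoeff, weight, h]

end Laurent

end DipperDonkin

/-! ### The representation, built row by row -/

namespace DipperDonkin

open TensorProduct

universe u

/-- A quantum matrix with `m` rows acting on a space with a basis indexed by integer exponents, in
such a way that a generator acts as multiplication by the corresponding variable on the monomials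
that do not involve any earlier row. -/
theorem exists_quantumMatrix_end {K : Type u} [Field K] {q : K} (hq : q ≠ 0) (n m : ℕ) :
    ∃ (V : Type u) (_ : AddCommGroup V) (_ : Module K V)
      (b : Module.Basis (Fin m → Fin n → ℤ) K V) (e : Fin m → Fin n → Module.End K V),
      IsQuantumMatrix q e ∧ ∀ i j α, (∀ r < i, α r = 0) →
        e i j (b α) = b (α + Pi.single i (Pi.single j 1)) := by
  induction m with
  | zero =>
    exact ⟨(Fin 0 → Fin n → ℤ) →₀ K, inferInstance, inferInstance, Finsupp.basisSingleOne,
      Fin.elim0, ⟨fun i => i.elim0, fun i => i.elim0, fun i => i.elim0⟩, fun i => i.elim0⟩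
  | succ m ih =>
    obtain ⟨V, _, _, b, e, he, hb⟩ := ih
    let F : Module.End K ((Fin n → ℤ) →₀ K) →ₐ[K]
        Module.End K (((Fin n → ℤ) →₀ K) ⊗[K] V) :=
      Module.End.rTensorAlgHom K _ V
    let G : Module.End K V →ₐ[K] Module.End K (((Fin n → ℤ) →₀ K) ⊗[K] V) :=
      Module.End.lTensorAlgHom K V _
    have hF : ∀ f x y, F f (x ⊗ₜ y) = f x ⊗ₜ y := fun _ _ _ => rfl
    have hG : ∀ g x y, G g (x ⊗ₜ y) = x ⊗ₜ g y := fun _ _ _ => rfl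
    have hFG : ∀ g f, G g * F f = F f * G g := fun g f => TensorProduct.ext' fun x y => rfl
    -- The row index of `transfer` is a column index of the old matrix `e`, so the later rows form a
    -- matrix product of two quantum matrices acting on different tensor factors.
    let E : Fin (m + 1) → Fin n → Module.End K (((Fin n → ℤ) →₀ K) ⊗[K] V) :=
      Fin.cons (fun j => F (mulVar K j)) fun i j => ∑ k, G (e i k) * F (transfer q k j)
    have hE0 : ∀ j, E 0 j = F (mulVar K j) := fun _ => rfl
    have hE : ∀ i j, E (Fin.succ i) j = ∑ k, G (e i k) * F (transfer q k j) := fun _ _ => rfl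
    have hQ : IsQuantumMatrix q fun i j => ∑ k, G (e i k) * F (transfer q k j) :=
      (he.map G).mul hq ((isQuantumMatrix_transfer hq).map F) fun _ _ _ _ => hFG _ _
    have hleft : ∀ i j t, E (Fin.succ i) j * E 0 t =
        ∑ k, G (e i k) * F (transfer q k j * mulVar K t) := by
      intro i j t
      rw [hE, hE0, Finset.sum_mul]
      exact Finset.sum_congr rfl fun k _ => by rw [mul_assoc, map_mul]
    have hright : ∀ i j t, E 0 t * E (Fin.succ i) j =
        ∑ k, G (e i k) * F (mulVar K t * transfer q k j) := by
      intro i j t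
      rw [hE, hE0, Finset.mul_sum]
      exact Finset.sum_congr rfl fun k _ => by rw [← mul_assoc, ← hFG, mul_assoc, map_mul]
    refine ⟨((Fin n → ℤ) →₀ K) ⊗[K] V, inferInstance, inferInstance,
      (Finsupp.basisSingleOne.tensorProduct b).reindex (Fin.consEquiv fun _ => Fin n → ℤ), E,
      ⟨?_, ?_, ?_⟩, ?_⟩
    · intro i s j t hsi hjt
      induction i using Fin.cases with
      | zero => exact absurd hsi (Fin.not_lt_zero s)
      | succ i =>
        induction s using Fin.cases with
        | zero =>
          rw [hleft, hright, Finset.smul_sum]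
          refine Finset.sum_congr rfl fun k _ => ?_
          rw [transfer_mul_mulVar_of_le hq k hjt, map_smul, mul_smul_comm]
        | succ s => exact hQ.qcomm i s j t (Fin.succ_lt_succ_iff.1 hsi) hjt
    · intro i s j t hsi hjt
      induction i using Fin.cases with
      | zero => exact absurd hsi (Fin.not_lt_zero s)
      | succ i =>
        induction s using Fin.cases with
        | zero =>
          rw [hleft, hright, hright, Finset.smul_sum, ← Finset.sum_add_distrib]
          refine Finset.sum_congr rfl fun k _ => ?_
          rw [transfer_mul_mulVar_of_lt hq k hjt, map_add, map_smul, mul_add, mul_smul_comm]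
        | succ s => exact hQ.cross i s j t (Fin.succ_lt_succ_iff.1 hsi) hjt
    · intro i j k
      induction i using Fin.cases with
      | zero => rw [hE0, hE0, ← map_mul, mulVar_comm, map_mul]
      | succ i => exact hQ.row i j k
    · intro i j α hα
      simp only [Module.Basis.reindex_apply, Module.Basis.tensorProduct_apply',
        Finsupp.coe_basisSingleOne, Fin.consEquiv_symm_apply]
      induction i using Fin.cases with
      | zero =>
        rw [hE0, hF, mulVar, laurentOp_single]
        congr 1
        · simp
        · congr 1
          ext r : 1
          simp [Fin.tail]
      | succ i =>
        -- The Laurent factor is the constant 1, so only the summand `k = j` survives.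
        have h0 : α 0 = 0 := hα 0 (Fin.succ_pos i)
        rw [hE, LinearMap.sum_apply, Finset.sum_eq_single j]
        · rw [Module.End.mul_apply, hF, hG, h0, transfer_single_zero, if_pos rfl,
            hb i j (Fin.tail α) fun r hr => hα _ (Fin.succ_lt_succ_iff.2 hr)]
          congr 2
          · simp [h0]
          · ext r : 1
            simp [Fin.tail, Pi.single_apply]
        · intro k _ hk
          rw [Module.End.mul_apply, hF, h0, transfer_single_zero, if_neg hk, zero_tmul, map_zero]
        · simp

end DipperDonkin

/-! ### PBW basis and straightening for the quantized matrix algebra -/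

namespace DipperDonkin

open SolvablePoly

variable {K : Type*} [Field K] {q : K} {n : ℕ}

variable (q n) in
/-- The generators, indexed by the lexicographically ordered pairs. -/
def lexGen (p : Fin n ×ₗ Fin n) : Dq q n := gen q n (ofLex p).1 (ofLex p).2

lemma isQuantumMatrix_gen : IsQuantumMatrix q (gen q n) where
  qcomm i s j t h h' := by
    simpa [gen] using RingQuot.mkAlgHom_rel K (Rel.qcomm (q := q) i j s t h h')
  cross i s j t h h' := by
    simpa [gen] using RingQuot.mkAlgHom_rel K (Rel.cross (q := q) i j s t h h')
  row i j k := by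
    simpa [gen] using RingQuot.mkAlgHom_rel K (Rel.row (q := q) i j k)

lemma adjoin_range_lexGen : Algebra.adjoin K (Set.range (lexGen q n)) = ⊤ := by
  have h : Set.range (lexGen q n) =
      RingQuot.mkAlgHom K (Rel q n) '' Set.range (FreeAlgebra.ι K) := by
    rw [← Set.range_comp]
    ext x
    exact ⟨fun ⟨p, hp⟩ => ⟨ofLex p, hp⟩, fun ⟨p, hp⟩ => ⟨toLex p, hp⟩⟩
  rw [h, ← AlgHom.map_adjoin, FreeAlgebra.adjoin_range_ι, Algebra.map_top,
    (AlgHom.range_eq_top _).2 (RingQuot.mkAlgHom_surjective K _)]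

/-- A quantum matrix induces a homomorphism from the quantized matrix algebra. -/
lemma exists_algHom_gen {A : Type*} [Ring A] [Algebra K A] {e : Fin n → Fin n → A}
    (he : IsQuantumMatrix q e) : ∃ f : Dq q n →ₐ[K] A, ∀ i j, f (gen q n i j) = e i j := by
  refine ⟨RingQuot.liftAlgHom K ⟨FreeAlgebra.lift K fun p => e p.1 p.2, ?_⟩, fun i j => ?_⟩
  · rintro _ _ (⟨i, j, s, t, h, h'⟩ | ⟨i, j, s, t, h, h'⟩ | ⟨i, j, k⟩)
    · simpa using he.qcomm i s j t h h'
    · simpa using he.cross i s j t h h'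
    · simpa using he.row i j k
  · rw [gen, RingQuot.liftAlgHom_mkAlgHom_apply, FreeAlgebra.lift_ι_apply]

lemma linearIndependent_orderedMonomial (hq : q ≠ 0) :
    LinearIndependent K (orderedMonomial (lexGen q n)) := by
  obtain ⟨V, _, _, b, e, he, hb⟩ := exists_quantumMatrix_end hq n n
  obtain ⟨f, hf⟩ := exists_algHom_gen he
  let emb : (Fin n ×ₗ Fin n → ℕ) → Fin n → Fin n → ℤ := fun α i j => α (toLex (i, j))
  have hemb : Function.Injective emb := fun α β h => funext fun p =>
    Nat.cast_injective (congrFun (congrFun h (ofLex p).1) (ofLex p).2)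
  have hword : ∀ l : List (Fin n ×ₗ Fin n), l.Pairwise (· ≤ ·) →
      f (word (lexGen q n) l) (b 0) = b (emb (wordExp l)) := by
    intro l hl
    induction l with
    | nil =>
      rw [word_nil, map_one, Module.End.one_apply, wordExp_nil]
      rfl
    | cons p l ih =>
      rw [List.pairwise_cons] at hl
      rw [word_cons, map_mul, Module.End.mul_apply, ih hl.2, lexGen, hf, hb]
      · congr 1
        rw [wordExp_cons]
        ext i j
        have : (toLex (i, j) = p) ↔ (i = (ofLex p).1 ∧ j = (ofLex p).2) := by
          rw [← ofLex_inj, ofLex_toLex, Prod.ext_iff]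
        by_cases hi : i = (ofLex p).1
        · subst hi
          simp [emb, Pi.single_apply, this, add_comm]
        · simp [emb, this, hi]
      -- Factors act from the right, and the word is sorted: the tail involves no row before that of
      -- `p`, as `hb` requires.
      · intro r hr
        ext j
        simp only [emb, Pi.zero_apply, Nat.cast_eq_zero, wordExp, List.count_eq_zero]
        intro hmem
        have := (Prod.Lex.monotone_fst _ _ (hl.1 _ hmem))
        exact absurd hr (not_lt.2 this)
  refine LinearIndependent.of_comp ((LinearMap.applyₗ (b 0)).comp f.toLinearMap) ?_
  convert! b.linearIndependent.comp emb hemb using 1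
  ext α : 1
  have := hword _ (pairwise_sortedWord α)
  rwa [word_sortedWord, wordExp_sortedWord] at this

/-- Both degrees are 2, and the first difference is at `i`, where the exponents are 0 and 1. -/
lemma orderKey_degLex_single_add_single_lt {ι : Type*} [LinearOrder ι] [Fintype ι] {i j u v : ι}
    (hj : i < j) (hu : i < u) (hv : i < v) :
    orderKey MonomialOrder.degLex (Pi.single u 1 + Pi.single v 1) <
      orderKey MonomialOrder.degLex (Pi.single i 1 + Pi.single j 1 : ι → ℕ) := by
  have key : ∀ x y : ι, orderKey MonomialOrder.degLex (Pi.single x 1 + Pi.single y 1 : ι → ℕ) =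
      MonomialOrder.degLex.toSyn (Finsupp.single x 1 + Finsupp.single y 1) := by
    intro x y
    have h : (Finsupp.linearEquivFunOnFinite ℕ ℕ ι).symm (Pi.single x 1 + Pi.single y 1) =
        Finsupp.single x 1 + Finsupp.single y 1 := by simp
    exact congrArg MonomialOrder.degLex.toSyn h
  rw [key, key, MonomialOrder.degLex_lt_iff, Finsupp.DegLex.lt_iff]
  refine Or.inr ⟨by simp, i, fun k hk => ?_, ?_⟩
  · simp [hk.ne', (hk.trans hj).ne', (hk.trans hu).ne', (hk.trans hv).ne']
  · simp [hj.ne', hu.ne', hv.ne']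

/-- Interchanging two generators: the correction term is a multiple of a smaller monomial. -/
lemma exists_lexGen_mul_lexGen (hq : q ≠ 0) {i j : Fin n ×ₗ Fin n} (h : i < j) :
    ∃ c : K, c ≠ 0 ∧ ∃ (r : K) (u v : Fin n ×ₗ Fin n), u ≤ v ∧ i < u ∧
      lexGen q n j * lexGen q n i =
        c • (lexGen q n i * lexGen q n j) + r • (lexGen q n u * lexGen q n v) := by
  have hr := isQuantumMatrix_gen (q := q) (n := n)
  induction i using Lex.rec with | _ i
  induction j using Lex.rec with | _ j
  obtain ⟨s, t⟩ := i
  obtain ⟨i, j⟩ := j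
  simp only [lexGen, ofLex_toLex]
  rcases Prod.Lex.toLex_lt_toLex.1 h with hsi | ⟨rfl, -⟩
  · rcases le_or_gt j t with hjt | htj
    · refine ⟨q, hq, 0, toLex (i, j), toLex (i, j), le_rfl, h, ?_⟩
      rw [zero_smul, add_zero]
      exact hr.qcomm i s j t hsi hjt
    · refine ⟨1, one_ne_zero, q - 1, toLex (s, j), toLex (i, t), ?_, ?_, ?_⟩
      · exact Prod.Lex.toLex_le_toLex.2 (Or.inl hsi)
      · exact Prod.Lex.toLex_lt_toLex.2 (Or.inr ⟨rfl, htj⟩)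
      · rw [one_smul]
        exact hr.cross i s j t hsi htj
  · refine ⟨1, one_ne_zero, 0, toLex (s, j), toLex (s, j), le_rfl, h, ?_⟩
    rw [zero_smul, add_zero, one_smul]
    exact hr.row s j t

lemma isStraightening_lexGen (hq : q ≠ 0) :
    IsStraightening K MonomialOrder.degLex (lexGen q n) := by
  intro i j h
  obtain ⟨c, hc, r, u, v, huv, hiu, e⟩ := exists_lexGen_mul_lexGen hq h
  refine ⟨c, hc, ?_⟩
  rw [e, add_sub_cancel_left]
  refine Submodule.smul_mem _ _ (Submodule.subset_span ⟨[u, v], ?_, by simp⟩)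
  simpa using orderKey_degLex_single_add_single_lt h hiu (hiu.trans_le huv)

end DipperDonkin

theorem theorem3p3 (K : Type*) [Field K] [CharZero K] (n : ℕ) (hn : 2 ≤ n) (q : K) (hq : q ≠ 0) :
    SolvablePoly.IsSolvablePolynomialAlgebra K
      (fun p : Fin n ×ₗ Fin n => DipperDonkin.gen q n (ofLex p).1 (ofLex p).2) := by
  have hS := DipperDonkin.isStraightening_lexGen (n := n) hq
  have hspan := SolvablePoly.span_orderedMonomial_eq_top hS DipperDonkin.adjoin_range_lexGen
  let b := Module.Basis.mk (DipperDonkin.linearIndependent_orderedMonomial (n := n) hq) hspan.ge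
  have hb : SolvablePoly.IsPBWBasis (DipperDonkin.lexGen q n) b := fun α => by simp [b]
  refine ⟨b, hb, _, SolvablePoly.isMonomialOrdering_of_isStraightening hS hb, fun i j h => ?_⟩
  obtain ⟨c, hc, r, u, v, huv, hiu, e⟩ := DipperDonkin.exists_lexGen_mul_lexGen hq h
  refine ⟨c, hc, r • (DipperDonkin.lexGen q n u * DipperDonkin.lexGen q n v), e, fun hne => ?_⟩
  have huv' : DipperDonkin.lexGen q n u * DipperDonkin.lexGen q n v =
      b (Pi.single u 1 + Pi.single v 1) := by
    rw [hb]
    have hp := SolvablePoly.word_sortedWord (DipperDonkin.lexGen q n)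
      (Pi.single u 1 + Pi.single v 1)
    -- Since `u ≤ v`, the correction word is already sorted, so it is a single basis element and its
    -- own leading monomial.
    have hl : [u, v] = SolvablePoly.sortedWord (Pi.single u 1 + Pi.single v 1) :=
      List.Perm.eq_of_pairwise (fun _ _ _ _ => le_antisymm) (by simpa using huv)
        (SolvablePoly.pairwise_sortedWord _) (SolvablePoly.wordExp_eq_iff_perm.1 (by simp))
    rw [← hp, ← hl]
    simp
  have hr : r ≠ 0 := fun h0 => hne (by rw [h0, zero_smul])
  refine ⟨Pi.single u 1 + Pi.single v 1, ⟨?_, fun δ hδ => Or.inl ?_⟩,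
    DipperDonkin.orderKey_degLex_single_add_single_lt h hiu (hiu.trans_le huv)⟩
  · simpa [huv'] using hr
  · by_contra hne'
    refine hδ ?_
    rw [huv', map_smul, Module.Basis.repr_self, Finsupp.smul_apply,
      Finsupp.single_eq_of_ne hne', smul_zero]
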